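/- **Setting.** Fix integers $n\ge 1$, $K\ge 1$ and a constant $\sigma>0$. A *Markov jump affine model* consists of parameters $\theta=(A_k,b_k)_{k=1}^K$ with $A_k\in\mathbb R^{n\times n}$, $b_k\in\mathbb R^n$, a stochastic matrix $P=(p_{ij})\in\mathbb R^{K\times K}$ and noise distributions $f_1,\dots,f_K$ on $\mathbb R^n$. At each time $t\ge 1$ an input $x_t\in\mathbb R^n$ is chosen; then, given the past and $x_t$, the state $s_t=j$ is drawn with probability $p_{s_{t-1},j}$, and $y_t=A_{s_t}x_t+b_{s_t}+w_t$ is observed, where $w_t\sim f_{s_t}$ is independent of the past and of $x_t$ given $s_t$. The initial state $s_0$ has an arbitrary law $\pi_0$. A *policy* $\mu$ chooses $x_t=x_t^\mu$, possibly at random, on the basis of the history $I_{t-1}=(s_0,(x_r,y_r,s_r)_{r=1}^{t-1})$; that is, it prescribes the conditional law of $x_t$ given $I_{t-1}$, and this prescription does not depend on the model. A *sequence of optimal-input estimates* $(\hat x_t^\mu)_{t\ge 1}$ likewise prescribes a conditional law of $\hat x_t^\mu\in\mathbb R^n$ given the history $I_{t-1}$ generated under $\mu$. The stage cost is minus the expected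 revenue, $J(i,x)=\mathbb E(-x\cdot y_t\mid s_{t-1}=i,\,x_t=x)$. When all $A_j$ are negative definite ($x^{\mathsf T}A_jx<0$ for $x\ne0$; symmetry is not required) and the noise has mean zero, it is minimized over $x\in\mathbb R^n$ by the optimal input $$x_i^*=x_i^*(\theta,P)=-\Big(\sum_j p_{ij}(A_j+A_j^{\mathsf T})\Big)^{-1}\sum_j p_{ij}b_j .$$ Let $\Pi\subset\mathbb R^n$ be compact and convex, and let $\Theta\subset(\mathbb R^{n\times n}\times\mathbb R^n)^K$ be compact, with $A_k$ negative definite for every $k$ and every $\theta\in\Theta$. Assume that the set of those $\theta\in\Theta$ whose optimal inputs for equal transition probabilities $p_{ij}=1/K$ lie in $\Pi$ has non-empty interior (this holds, for instance, if $\Theta$ has non-empty interior and $\Pi$ contains the optimal inputs for all $\theta\in\Theta$ and all $P$). A model is *admissible* if $\theta\in\Theta$, $x_i^*(\theta,P)\in\Pi$ for all $i$, and each $f_k$ has mean zero and finite second moments, with $\mathbb E(w_{(l)}^2)\le\sigma^2$ for each entry $w_{(l)}$ of $w\sim f_k$. For $T\ge0$ define, with suprema over all admissible models $(\theta,P,f)$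 and values in $[0,\infty]$, the worst-case cumulative estimation-MSE, the worst-case cumulative input-MSE and the worst-case regret $$\hat{\mathcal E}_T^\mu=\sup\mathbb E\sum_{t=1}^T\|\hat x_t^\mu-x_{s_{t-1}}^*\|_2^2,\qquad \bar{\mathcal E}_T^\mu=\sup\mathbb E\sum_{t=1}^T\|x_t^\mu-x_{s_{t-1}}^*\|_2^2,$$ $$\bar{\mathcal R}_T^\mu=\sup\mathbb E\sum_{t=1}^T\big(J(s_{t-1},x_t^\mu)-J(s_{t-1},x_{s_{t-1}}^*)\big).$$ **Theorem.** There exist constants $C,C'>0$, depending only on $n,K,\Theta,\Pi,\sigma$, such that for every initial law $\pi_0$, every policy $\mu$, every sequence of estimates $(\hat x_t^\mu)$ and every $T$, $$\hat{\mathcal E}_T^\mu\,\bar{\mathcal E}_T^\mu\ge C^2T,\qquad \bar{\mathcal E}_T^\mu\ge C\sqrt T,\qquad \bar{\mathcal R}_T^\mu\ge C'\sqrt T .$$ -/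

import Mathlib

open MeasureTheory ProbabilityTheory
open scoped ENNReal

namespace MarkovJump

noncomputable section

/-- Inputs, outputs and noise live in `ℝⁿ` with the Euclidean norm. -/
abbrev Vec (n : ℕ) : Type := EuclideanSpace ℝ (Fin n)

/-- System parameters `θ = (A_k, b_k)_{k = 1, …, K}`, with `A_k ∈ ℝ^{n × n}` and `b_k ∈ ℝⁿ`. -/
abbrev Param (n K : ℕ) : Type := Fin K → Matrix (Fin n) (Fin n) ℝ × Vec n

/-- A real square matrix, not necessarily symmetric, is negative definite
if `xᵀ A x < 0` for all `x ≠ 0`. -/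
def NegDef {n : ℕ} (A : Matrix (Fin n) (Fin n) ℝ) : Prop :=
  ∀ x : Vec n, x ≠ 0 → inner ℝ x (A.toEuclideanLin x) < 0

/-- The optimal input after the previous state `i`:
`x*_i = - (∑_j p_{ij} (A_j + A_jᵀ))⁻¹ (∑_j p_{ij} b_j)`. That it minimizes the stage cost
is `Model.stageCost_optInput_le` below. -/
def optInput {n K : ℕ} (θ : Param n K) (P : Matrix (Fin K) (Fin K) ℝ) (i : Fin K) : Vec n :=
  -((∑ j, P i j • ((θ j).1 + (θ j).1.transpose))⁻¹.toEuclideanLin (∑ j, P i j • (θ j).2))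

/-- The transition matrix all of whose entries are `1 / K`. -/
def uniformTransition (K : ℕ) : Matrix (Fin K) (Fin K) ℝ := Matrix.of fun _ _ => 1 / (K : ℝ)

/-- A Markov jump affine model: parameters `θ`, a stochastic transition matrix `P` and, for each
state, a noise distribution on `ℝⁿ`. -/
structure Model (n K : ℕ) where
  θ : Param n K
  P : Matrix (Fin K) (Fin K) ℝ
  stochastic : P ∈ Matrix.rowStochastic ℝ (Fin K)
  noise : Fin K → ProbabilityMeasure (Vec n)

namespace Model

variable {n K : ℕ}

/-- The law of `(y_t, s_t)` given `s_{t-1} = i` and `x_t = x`: the state `s_t = j` is drawn with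
probability `p_{ij}`, the noise `w` from the distribution of state `j`, and
`y_t = A_j x + b_j + w`. -/
def outcome (m : Model n K) : Kernel (Fin K × Vec n) (Vec n × Fin K) where
  toFun p := ∑ j, ENNReal.ofReal (m.P p.1 j) •
    (m.noise j : Measure (Vec n)).map
      (fun w => ((m.θ j).1.toEuclideanLin p.2 + (m.θ j).2 + w, j))
  measurable' := by
    refine measurable_from_prod_countable_right fun i => ?_
    refine Measure.measurable_of_measurable_coe _ fun s hs => ?_
    simp only [Measure.coe_finsetSum, Finset.sum_apply, Measure.smul_apply, smul_eq_mul]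
    refine Finset.measurable_sum _ fun j _ => Measurable.const_mul ?_ _
    have hlin : Measurable fun x : Vec n => (m.θ j).1.toEuclideanLin x :=
      (LinearMap.continuous_of_finiteDimensional _).measurable
    have hmap : ∀ x : Vec n, Measurable fun w : Vec n =>
        ((m.θ j).1.toEuclideanLin x + (m.θ j).2 + w, j) := fun x => by fun_prop
    have hpair : Measurable fun q : Vec n × Vec n =>
        ((m.θ j).1.toEuclideanLin q.1 + (m.θ j).2 + q.2, j) := by fun_prop
    simp_rw [fun x => Measure.map_apply (μ := (m.noise j : Measure (Vec n))) (hmap x) hs]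
    exact measurable_measure_prodMk_left (ν := (m.noise j : Measure (Vec n))) (hpair hs)

theorem outcome_apply (m : Model n K) (p : Fin K × Vec n) :
    m.outcome p = ∑ j, ENNReal.ofReal (m.P p.1 j) •
      (m.noise j : Measure (Vec n)).map
        (fun w => ((m.θ j).1.toEuclideanLin p.2 + (m.θ j).2 + w, j)) := rfl

theorem P_nonneg (m : Model n K) (i j : Fin K) : 0 ≤ m.P i j :=
  (Matrix.mem_rowStochastic.1 m.stochastic).1 i j

theorem P_sum (m : Model n K) (i : Fin K) : ∑ j, m.P i j = 1 := by
  have h := congrFun (Matrix.mem_rowStochastic.1 m.stochastic).2 i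
  simpa [Matrix.mulVec, dotProduct] using h

instance (m : Model n K) : IsMarkovKernel m.outcome := by
  refine ⟨fun p => ⟨?_⟩⟩
  rw [outcome_apply]
  simp only [Measure.coe_finsetSum, Finset.sum_apply, Measure.smul_apply, smul_eq_mul]
  have h1 : ∀ j : Fin K, ((m.noise j : Measure (Vec n)).map
      (fun w => ((m.θ j).1.toEuclideanLin p.2 + (m.θ j).2 + w, j))) Set.univ = 1 := fun j => by
    rw [Measure.map_apply (by fun_prop) MeasurableSet.univ]
    simp
  simp_rw [h1, mul_one]
  rw [← ENNReal.ofReal_sum_of_nonneg fun j _ => m.P_nonneg _ _, m.P_sum, ENNReal.ofReal_one]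

/-- The stage cost (minus the expected revenue) `J(i, x) = E(- x · y_t | s_{t-1} = i, x_t = x)`. -/
def stageCost (m : Model n K) (i : Fin K) (x : Vec n) : ℝ :=
  ∫ z, -inner ℝ x z.1 ∂(m.outcome (i, x))

/-- The models over which the worst case is taken: the parameter lies in `Θ`, the optimal inputs
lie in `Π`, and the noise of each state has mean zero, finite variance, and second moments of its
entries at most `σ²`. -/
structure Admissible (Θ : Set (Param n K)) (Pi : Set (Vec n)) (σ : ℝ) (m : Model n K) : Prop where
  mem : m.θ ∈ Θ
  opt_mem : ∀ i, optInput m.θ m.P i ∈ Pi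
  memLp : ∀ k, MemLp (fun w => w) 2 (m.noise k : Measure (Vec n))
  mean_zero : ∀ k, ∫ w, w ∂(m.noise k : Measure (Vec n)) = 0
  second_moment : ∀ k (i : Fin n), ∫ w, w i ^ 2 ∂(m.noise k : Measure (Vec n)) ≤ σ ^ 2

end Model

/-- The information available before `x_{t+1}` is chosen: the initial state `s_0` and the triples
`(x_i, y_i, s_i)` for `i = 1, …, t`. -/
abbrev History (n K t : ℕ) : Type := Fin K × (Fin t → Vec n × Vec n × Fin K)

/-- The most recent state `s_t` of a history. -/
def History.last {n K : ℕ} : (t : ℕ) → History n K t → Fin K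
  | 0, h => h.1
  | t + 1, h => (h.2 (Fin.last t)).2.2

/-- Append the record `(x_{t+1}, y_{t+1}, s_{t+1})` to a history. -/
def History.extend {n K t : ℕ} (p : (History n K t × Vec n) × (Vec n × Fin K)) :
    History n K (t + 1) :=
  (p.1.1.1, Fin.snoc (α := fun _ => Vec n × Vec n × Fin K) p.1.1.2 (p.1.2, p.2.1, p.2.2))

theorem History.measurable_last {n K : ℕ} (t : ℕ) :
    Measurable (History.last (n := n) (K := K) t) := by
  cases t with
  | zero => exact measurable_fst
  | succ t =>
    exact ((measurable_pi_apply (Fin.last t)).comp measurable_snd).snd.snd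

theorem History.measurable_extend {n K t : ℕ} :
    Measurable (History.extend (n := n) (K := K) (t := t)) := by
  refine Measurable.prodMk (by fun_prop) (measurable_pi_lambda _ fun i => ?_)
  refine Fin.lastCases ?_ (fun j => ?_) i
  · simp only [Fin.snoc_last]
    fun_prop
  · simp only [Fin.snoc_castSucc]
    exact (measurable_pi_apply j).comp (by fun_prop)

/-- A (possibly randomized) decision rule for every time: given the history up to time `t`, the law
of a vector in `ℝⁿ`. Deterministic rules are the Dirac kernels. -/
structure Rules (n K : ℕ) where
  rule : (t : ℕ) → Kernel (History n K t) (Vec n)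
  markov : ∀ t, IsMarkovKernel (rule t)

/-- A policy: `rule t` is the law of the input `x_{t+1}` given the history up to time `t`. -/
abbrev Policy (n K : ℕ) : Type := Rules n K

/-- A sequence of optimal-input estimates: `rule t` is the law of the estimate of the optimal
input at time `t + 1` given the history up to time `t`. -/
abbrev Estimator (n K : ℕ) : Type := Rules n K

instance {n K : ℕ} (μ : Rules n K) (t : ℕ) : IsMarkovKernel (μ.rule t) := μ.markov t

variable {n K : ℕ}

/-- The law of the history up to time `t` when the policy `μ` runs on the model `m` and `s_0` has
law `init`. -/
def law (m : Model n K) (init : ProbabilityMeasure (Fin K)) (μ : Policy n K) :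
    (t : ℕ) → Measure (History n K t)
  | 0 => (init : Measure (Fin K)).map fun s => (s, Fin.elim0)
  | t + 1 =>
    ((law m init μ t ⊗ₘ μ.rule t) ⊗ₘ
      (m.outcome.comap (fun p => (History.last t p.1, p.2))
        (((History.measurable_last t).comp measurable_fst).prodMk measurable_snd))).map
      History.extend

instance (m : Model n K) (init : ProbabilityMeasure (Fin K)) (μ : Policy n K) (t : ℕ) :
    IsProbabilityMeasure (law m init μ t) := by
  induction t with
  | zero => exact Measure.isProbabilityMeasure_map (by fun_prop)
  | succ t ih => exact Measure.isProbabilityMeasure_map History.measurable_extend.aemeasurable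

/-- Cumulative mean squared error `E ∑_{t=1}^T ‖z_t - x*_{s_{t-1}}‖²`, where the history is generated
by the policy `μ` and `z_t` has, given the history up to time `t - 1`, the law prescribed by `r`
(written as the sum over `t` of the expectations). -/
def cumMSE (m : Model n K) (init : ProbabilityMeasure (Fin K)) (μ : Policy n K) (r : Rules n K)
    (T : ℕ) : ℝ≥0∞ :=
  ∑ t ∈ Finset.range T, ∫⁻ h, ∫⁻ z,
    ENNReal.ofReal (‖z - optInput m.θ m.P (History.last t h)‖ ^ 2) ∂(r.rule t h) ∂(law m init μ t)

/-- The regret `E ∑_{t=1}^T (J(s_{t-1}, x_t) - J(s_{t-1}, x*_{s_{t-1}}))` of the policy `μ` on the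
model `m`. The differences are nonnegative by `Model.stageCost_optInput_le`, so the
expectation is taken in `[0, ∞]`. -/
def regret (m : Model n K) (init : ProbabilityMeasure (Fin K)) (μ : Policy n K) (T : ℕ) : ℝ≥0∞ :=
  ∑ t ∈ Finset.range T, ∫⁻ h, ∫⁻ x,
    ENNReal.ofReal (m.stageCost (History.last t h) x -
      m.stageCost (History.last t h) (optInput m.θ m.P (History.last t h)))
      ∂(μ.rule t h) ∂(law m init μ t)

/-- Worst-case cumulative estimation-MSE of the estimates `e` under the policy `μ`. -/
def worstEstimationMSE (Θ : Set (Param n K)) (Pi : Set (Vec n)) (σ : ℝ)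
    (init : ProbabilityMeasure (Fin K)) (μ : Policy n K) (e : Estimator n K) (T : ℕ) : ℝ≥0∞ :=
  ⨆ (m : Model n K) (_ : m.Admissible Θ Pi σ), cumMSE m init μ e T

/-- Worst-case cumulative input-MSE of the policy `μ`. -/
def worstInputMSE (Θ : Set (Param n K)) (Pi : Set (Vec n)) (σ : ℝ)
    (init : ProbabilityMeasure (Fin K)) (μ : Policy n K) (T : ℕ) : ℝ≥0∞ :=
  ⨆ (m : Model n K) (_ : m.Admissible Θ Pi σ), cumMSE m init μ μ T

/-- Worst-case regret of the policy `μ`. -/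
def worstRegret (Θ : Set (Param n K)) (Pi : Set (Vec n)) (σ : ℝ)
    (init : ProbabilityMeasure (Fin K)) (μ : Policy n K) (T : ℕ) : ℝ≥0∞ :=
  ⨆ (m : Model n K) (_ : m.Admissible Θ Pi σ), regret m init μ T

namespace Model

theorem stageCost_eq (m : Model n K)
    (hint : ∀ k, Integrable (fun w => w) (m.noise k : Measure (Vec n)))
    (hmean : ∀ k, ∫ w, w ∂(m.noise k : Measure (Vec n)) = 0) (i : Fin K) (x : Vec n) :
    m.stageCost i x = -∑ j, m.P i j * inner ℝ x ((m.θ j).1.toEuclideanLin x + (m.θ j).2) := by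
  have hm : ∀ j : Fin K, Measurable fun w : Vec n =>
      ((m.θ j).1.toEuclideanLin x + (m.θ j).2 + w, j) := fun j => by fun_prop
  have hI : ∀ j : Fin K, Integrable (fun w : Vec n =>
      -inner ℝ x ((m.θ j).1.toEuclideanLin x + (m.θ j).2 + w)) (m.noise j : Measure (Vec n)) :=
    fun j => (((integrable_const _).add (hint j)).const_inner x).neg
  have hs : StronglyMeasurable fun z : Vec n × Fin K => -inner ℝ x z.1 :=
    (by fun_prop : Measurable fun z : Vec n × Fin K => -inner ℝ x z.1).stronglyMeasurable
  have hmap : ∀ j : Fin K, Integrable (fun z : Vec n × Fin K => -inner ℝ x z.1)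
      ((m.noise j : Measure (Vec n)).map
        (fun w => ((m.θ j).1.toEuclideanLin x + (m.θ j).2 + w, j))) := fun j =>
    (integrable_map_measure hs.aestronglyMeasurable (hm j).aemeasurable).2 (hI j)
  rw [stageCost, outcome_apply, integral_finsetSum_measure
    fun j _ => (hmap j).smul_measure ENNReal.ofReal_ne_top, ← Finset.sum_neg_distrib]
  refine Finset.sum_congr rfl fun j _ => ?_
  have hadd : Integrable (fun w : Vec n => (m.θ j).1.toEuclideanLin x + (m.θ j).2 + w)
      (m.noise j : Measure (Vec n)) := (integrable_const _).add (hint j)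
  have h1 : ∫ w, inner ℝ x ((m.θ j).1.toEuclideanLin x + (m.θ j).2 + w)
      ∂(m.noise j : Measure (Vec n)) = inner ℝ x ((m.θ j).1.toEuclideanLin x + (m.θ j).2) := by
    rw [integral_inner hadd, integral_add (integrable_const _) (hint j), hmean j]
    simp
  rw [integral_smul_measure, integral_map (hm j).aemeasurable hs.aestronglyMeasurable,
    ENNReal.toReal_ofReal (m.P_nonneg i j), integral_neg, h1, smul_eq_mul, mul_neg]

/-- For negative definite `A_j` and centred noise, the optimal input minimizes the stage cost. -/
theorem stageCost_optInput_le (m : Model n K)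
    (hint : ∀ k, Integrable (fun w => w) (m.noise k : Measure (Vec n)))
    (hmean : ∀ k, ∫ w, w ∂(m.noise k : Measure (Vec n)) = 0)
    (hneg : ∀ k, NegDef (m.θ k).1) (i : Fin K) (x : Vec n) :
    m.stageCost i (optInput m.θ m.P i) ≤ m.stageCost i x := by
  rw [m.stageCost_eq hint hmean, m.stageCost_eq hint hmean, neg_le_neg_iff]
  set S := ∑ j, m.P i j • ((m.θ j).1 + (m.θ j).1.transpose) with hS
  set v := ∑ j, m.P i j • (m.θ j).2 with hv
  set z := optInput m.θ m.P i with hz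
  have hadj : ∀ (B : Matrix (Fin n) (Fin n) ℝ) (a c : Vec n),
      inner ℝ a (B.transpose.toEuclideanLin c) = inner ℝ c (B.toEuclideanLin a) := fun B a c => by
    have h := Matrix.toEuclideanLin_conjTranspose_eq_adjoint B
    rw [Matrix.conjTranspose_eq_transpose_of_trivial] at h
    rw [h, LinearMap.adjoint_inner_right, real_inner_comm]
  have hSapp : ∀ a c : Vec n, inner ℝ a (S.toEuclideanLin c) = ∑ j, m.P i j *
      (inner ℝ a ((m.θ j).1.toEuclideanLin c) + inner ℝ c ((m.θ j).1.toEuclideanLin a)) :=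
    fun a c => by
      simp only [hS, map_sum, map_smul, map_add, LinearMap.sum_apply, LinearMap.smul_apply,
        LinearMap.add_apply, inner_sum, inner_smul_right, inner_add_right, hadj]
  have hle : ∀ a : Vec n, ∀ j, m.P i j * inner ℝ a ((m.θ j).1.toEuclideanLin a) ≤ 0 :=
    fun a j => by
      refine mul_nonpos_of_nonneg_of_nonpos (m.P_nonneg i j) ?_
      by_cases ha : a = 0
      · simp [ha]
      · exact (hneg j a ha).le
  have hunit : IsUnit S := by
    rw [← Matrix.mulVec_injective_iff_isUnit]
    refine (injective_iff_map_eq_zero (Matrix.mulVecLin S)).2 fun a ha => ?_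
    by_contra hne
    have hne' : (WithLp.toLp 2 a : Vec n) ≠ 0 := fun h => hne (by simpa using h)
    have h0 : S.toEuclideanLin (WithLp.toLp 2 a) = 0 := by
      rw [Matrix.mulVecLin_apply] at ha
      simp [Matrix.toLpLin_toLp, ha]
    have h1 := hSapp (WithLp.toLp 2 a) (WithLp.toLp 2 a)
    rw [h0, inner_zero_right] at h1
    obtain ⟨j, hj⟩ : ∃ j, 0 < m.P i j := by
      by_contra! hcon
      have := Finset.sum_nonpos fun j (_ : j ∈ Finset.univ) => hcon j
      rw [m.P_sum i] at this
      linarith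
    have h2 : ∑ j, m.P i j * (inner ℝ (WithLp.toLp 2 a : Vec n)
        ((m.θ j).1.toEuclideanLin (WithLp.toLp 2 a)) + inner ℝ (WithLp.toLp 2 a : Vec n)
        ((m.θ j).1.toEuclideanLin (WithLp.toLp 2 a))) < 0 := by
      refine Finset.sum_neg' (fun k _ => ?_) ⟨j, Finset.mem_univ j, ?_⟩
      · have := hle (WithLp.toLp 2 a) k
        linarith
      · have := mul_neg_of_pos_of_neg hj (hneg j _ hne')
        linarith
    linarith
  have hfoc : S.toEuclideanLin z + v = 0 := by
    have hcomp : S.toEuclideanLin (S⁻¹.toEuclideanLin v) = v := by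
      have hmul : S * S⁻¹ = 1 := Matrix.mul_nonsing_inv S ((Matrix.isUnit_iff_isUnit_det S).1 hunit)
      ext k
      simp [Matrix.toLpLin_apply, Matrix.mulVec_mulVec, hmul]
    rw [hz, optInput, map_neg, ← hS, ← hv, hcomp, neg_add_cancel]
  have key : ∑ j, m.P i j * inner ℝ x ((m.θ j).1.toEuclideanLin x + (m.θ j).2) -
      ∑ j, m.P i j * inner ℝ z ((m.θ j).1.toEuclideanLin z + (m.θ j).2) =
      inner ℝ (x - z) (S.toEuclideanLin z + v) +
        ∑ j, m.P i j * inner ℝ (x - z) ((m.θ j).1.toEuclideanLin (x - z)) := by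
    rw [inner_add_right, hSapp, hv, inner_sum, ← Finset.sum_sub_distrib, ← Finset.sum_add_distrib,
      ← Finset.sum_add_distrib]
    refine Finset.sum_congr rfl fun j _ => ?_
    simp only [map_sub, inner_sub_left, inner_sub_right, inner_add_right, inner_smul_right]
    ring
  rw [hfoc, inner_zero_right, zero_add] at key
  have := Finset.sum_nonpos fun j (_ : j ∈ Finset.univ) => hle (x - z) j
  linarith

end Model

end

end MarkovJump

/-! The bound expresses a conflict between exploring and exploiting, made quantitative by Le Cam's
two-point method. Take equal transition probabilities, so that the optimal input `z` is the same
after every state, and a parameter with `z k ≠ 0` in the interior of the allowed set. The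
perturbation `tilt` of size `δ` leaves the mean output at `z` unchanged, so inputs near `z` hardly
reveal it: with Gaussian noise of variance `σ²` in coordinate `k`, the information gathered under
the base model is at most `δ² / σ²` times the input-MSE (`lintegral_quadVar_le`). Yet the tilt moves
the optimal input by at least a multiple of `δ` (`exists_le_norm_optInput_tilt_sub`), because the
gradient of the revenue at `z` becomes `δ z_k e_k`.

Let `W` be the worst-case input-MSE and take `δ²` proportional to `1 / W`. Up to time `T` the two
models then cannot be told apart, and every estimate errs by order `δ²` per step in one of them
(`two_point_step`, `two_point_cumMSE`). Hence the estimation-MSE is at least of order `T / W`, which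
is the product bound. Using the inputs themselves as estimates gives `W² ≥ D T`, and uniform
negative definiteness turns input-MSE into regret (`mul_cumMSE_le_regret`). The base model and the
constants are fixed before the initial law, the policy and the horizon. -/

namespace MarkovJump

open scoped NNReal

/-! ### One-dimensional Gaussian computations -/

/-- Cameron–Martin formula on the line: a shift of a centred Gaussian is a change of density. -/
theorem lintegral_gaussianReal_shift {v : ℝ≥0} (hv : v ≠ 0) (d : ℝ) {F : ℝ → ℝ≥0∞}
    (hF : Measurable F) :
    ∫⁻ g, F (g + d) ∂gaussianReal 0 v =
      ∫⁻ g, F g * ENNReal.ofReal (Real.exp (g * d / v - d ^ 2 / v / 2)) ∂gaussianReal 0 v := by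
  have hv0 : (v : ℝ) ≠ 0 := by exact_mod_cast hv
  have h1 : ∫⁻ g, F (g + d) ∂gaussianReal 0 v = ∫⁻ g, F g ∂gaussianReal d v := by
    rw [← lintegral_map hF (measurable_add_const d), gaussianReal_map_add_const, zero_add]
  rw [h1, gaussianReal_of_var_ne_zero _ hv, gaussianReal_of_var_ne_zero _ hv,
    lintegral_withDensity_eq_lintegral_mul _ (measurable_gaussianPDF _ _) hF,
    lintegral_withDensity_eq_lintegral_mul _ (measurable_gaussianPDF _ _) (by fun_prop)]
  refine lintegral_congr fun g => ?_
  have h2 : gaussianPDF d v g =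
      gaussianPDF 0 v g * ENNReal.ofReal (Real.exp (g * d / v - d ^ 2 / v / 2)) := by
    rw [gaussianPDF_def, gaussianPDF_def, ← ENNReal.ofReal_mul (gaussianPDFReal_nonneg _ _ _),
      gaussianPDFReal_def, gaussianPDFReal_def]
    dsimp only
    rw [mul_assoc (_⁻¹), ← Real.exp_add]
    congr 3
    field_simp
    ring
  simp only [Pi.mul_apply, h2]
  ring

theorem integral_sq_gaussianReal (v : ℝ≥0) : ∫ g, g ^ 2 ∂gaussianReal 0 v = v := by
  have h := variance_eq_integral (μ := gaussianReal 0 v) (X := fun x => x) (by fun_prop)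
  rw [variance_fun_id_gaussianReal] at h
  simpa using h.symm

theorem integrable_sq_gaussianReal (v : ℝ≥0) : Integrable (fun g => g ^ 2) (gaussianReal 0 v) :=
  (memLp_id_gaussianReal' (μ := 0) (v := v) 2 (by simp)).integrable_sq

theorem lintegral_sq_add_gaussianReal (v : ℝ≥0) (a c : ℝ) :
    ∫⁻ g, ENNReal.ofReal ((a + g * c) ^ 2) ∂gaussianReal 0 v =
      ENNReal.ofReal (a ^ 2) + ENNReal.ofReal (c ^ 2 * v) := by
  have hid : Integrable (fun g : ℝ => g) (gaussianReal 0 v) :=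
    (memLp_id_gaussianReal' (μ := 0) (v := v) 1 (by simp)).integrable le_rfl
  have hexp : (fun g : ℝ => (a + g * c) ^ 2) =
      fun g => (a ^ 2 + 2 * a * c * g) + c ^ 2 * g ^ 2 := by
    funext g
    ring
  have hi1 : Integrable (fun g : ℝ => a ^ 2 + 2 * a * c * g) (gaussianReal 0 v) :=
    (integrable_const _).add (hid.const_mul _)
  have hi2 : Integrable (fun g : ℝ => c ^ 2 * g ^ 2) (gaussianReal 0 v) :=
    (integrable_sq_gaussianReal v).const_mul _
  rw [← ofReal_integral_eq_lintegral_ofReal (by rw [hexp]; exact hi1.add hi2)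
      (Filter.Eventually.of_forall fun g => sq_nonneg _), hexp, integral_add hi1 hi2,
    integral_add (integrable_const _) (hid.const_mul _), integral_const_mul, integral_const_mul,
    integral_sq_gaussianReal, integral_id_gaussianReal, ← ENNReal.ofReal_add (by positivity)
      (by positivity)]
  simp

/-! ### The Gaussian models -/

variable {n K : ℕ}

theorem single_eq_smul (k : Fin n) (g : ℝ) :
    (EuclideanSpace.single k g : Vec n) = g • EuclideanSpace.single k 1 := by
  ext i
  by_cases hi : i = k <;> simp [hi]

theorem continuous_single (k : Fin n) :
    Continuous fun g : ℝ => (EuclideanSpace.single k g : Vec n) := by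
  rw [funext (single_eq_smul k)]
  fun_prop

theorem measurable_single (k : Fin n) :
    Measurable fun g : ℝ => (EuclideanSpace.single k g : Vec n) :=
  (continuous_single k).measurable

/-- Gaussian noise of variance `v` in the `k`-th coordinate, and no noise in the others. -/
noncomputable def coordNoise (k : Fin n) (v : ℝ≥0) : ProbabilityMeasure (Vec n) :=
  ⟨(gaussianReal 0 v).map fun g => EuclideanSpace.single k g,
    Measure.isProbabilityMeasure_map (measurable_single k).aemeasurable⟩

theorem uniformTransition_stochastic (hK : 1 ≤ K) :
    uniformTransition K ∈ Matrix.rowStochastic ℝ (Fin K) := by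
  have hK0 : (K : ℝ) ≠ 0 := by
    have : K ≠ 0 := by omega
    exact_mod_cast this
  rw [Matrix.mem_rowStochastic]
  refine ⟨fun i j => by simp [uniformTransition], ?_⟩
  funext i
  simp [uniformTransition, Matrix.mulVec, dotProduct, hK0]

/-- The model with equal transition probabilities and noise `coordNoise k v` in every state. -/
noncomputable def gaussianModel (hK : 1 ≤ K) (θ : Param n K) (k : Fin n) (v : ℝ≥0) : Model n K where
  θ := θ
  P := uniformTransition K
  stochastic := uniformTransition_stochastic hK
  noise _ := coordNoise k v

/-- Admissibility only bounds second moments from above, so degenerate noise is allowed: entry `k`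
attains `σ²` and the others vanish. -/
theorem gaussianModel_admissible (hK : 1 ≤ K) {θ : Param n K} (k : Fin n) {v : ℝ≥0}
    {Θ : Set (Param n K)} {Pi : Set (Vec n)} {σ : ℝ} (hσ : (v : ℝ) = σ ^ 2) (hθ : θ ∈ Θ)
    (hPi : ∀ i, optInput θ (uniformTransition K) i ∈ Pi) :
    (gaussianModel hK θ k v).Admissible Θ Pi σ := by
  have hL : MemLp (fun g : ℝ => (EuclideanSpace.single k g : Vec n)) 2 (gaussianReal 0 v) := by
    refine (memLp_id_gaussianReal' (μ := 0) (v := v) 2 (by simp)).mono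
      (measurable_single k).aestronglyMeasurable (Filter.Eventually.of_forall fun g => ?_)
    simp
  have hae := (measurable_single k).aemeasurable (μ := gaussianReal 0 v)
  refine ⟨hθ, hPi, fun _ => ?_, fun _ => ?_, fun _ i => ?_⟩
  · exact (memLp_map_measure_iff (by fun_prop) hae).2 hL
  · change ∫ w, w ∂((gaussianReal 0 v).map fun g => (EuclideanSpace.single k g : Vec n)) = 0
    rw [integral_map hae (by fun_prop)]
    rw [funext (single_eq_smul k), integral_smul_const, integral_id_gaussianReal, zero_smul]
  · change ∫ w : Vec n, w i ^ 2
      ∂((gaussianReal 0 v).map fun g => (EuclideanSpace.single k g : Vec n)) ≤ σ ^ 2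
    rw [integral_map hae (by fun_prop)]
    by_cases hi : i = k
    · subst hi
      simp [integral_sq_gaussianReal, hσ]
    · simp [hi, sq_nonneg]

theorem lintegral_gaussianModel_outcome (hK : 1 ≤ K) (θ : Param n K) (k : Fin n) (v : ℝ≥0)
    (i : Fin K) (x : Vec n) {F : Vec n × Fin K → ℝ≥0∞} (hF : Measurable F) :
    ∫⁻ r, F r ∂(gaussianModel hK θ k v).outcome (i, x) =
      ∑ j, ENNReal.ofReal (1 / K) * ∫⁻ g,
        F ((θ j).1.toEuclideanLin x + (θ j).2 + EuclideanSpace.single k g, j)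
          ∂gaussianReal 0 v := by
  rw [Model.outcome_apply, lintegral_finsetSum_measure]
  refine Finset.sum_congr rfl fun j _ => ?_
  rw [lintegral_smul_measure, lintegral_map hF (by fun_prop)]
  change _ * ∫⁻ w, _ ∂((gaussianReal 0 v).map fun g => (EuclideanSpace.single k g : Vec n)) = _
  rw [lintegral_map (by fun_prop) (measurable_single k)]
  rfl

/-- The parameters `A_j + δ E_kk`, `b_j - δ z_k e_k`: they change the mean output at the input `x`
by `δ (x_k - z_k) e_k`, hence not at all at `x = z`. -/
noncomputable def tilt (θ : Param n K) (k : Fin n) (z : Vec n) (δ : ℝ) : Param n K := fun j =>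
  ((θ j).1 + δ • Matrix.single k k 1, (θ j).2 - EuclideanSpace.single k (δ * z k))

theorem toEuclideanLin_single (k : Fin n) (x : Vec n) :
    (Matrix.single k k (1 : ℝ)).toEuclideanLin x = EuclideanSpace.single k (x k) := by
  ext i
  by_cases hi : i = k
  · subst hi
    simp [Matrix.toLpLin_apply, Matrix.single_mulVec]
  · simp [Matrix.toLpLin_apply, Matrix.single_mulVec, hi]

theorem tilt_mean (θ : Param n K) (k : Fin n) (z : Vec n) (δ : ℝ) (j : Fin K) (x : Vec n) :
    (tilt θ k z δ j).1.toEuclideanLin x + (tilt θ k z δ j).2 =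
      (θ j).1.toEuclideanLin x + (θ j).2 + EuclideanSpace.single k (δ * (x k - z k)) := by
  simp only [tilt, map_add, map_smul, LinearMap.add_apply, LinearMap.smul_apply,
    toEuclideanLin_single]
  ext i
  by_cases hi : i = k
  · subst hi
    simp
    ring
  · simp [hi]

@[simp] theorem tilt_zero (θ : Param n K) (k : Fin n) (z : Vec n) : tilt θ k z 0 = θ := by
  funext j
  ext i <;> simp [tilt]

/-- The deviation of the `k`-th output coordinate from its mean under `θ`. -/
noncomputable def residual (θ : Param n K) (k : Fin n) (r : Vec n × Vec n × Fin K) : ℝ :=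
  (r.2.1 - ((θ r.2.2).1.toEuclideanLin r.1 + (θ r.2.2).2)) k

theorem measurable_residual (θ : Param n K) (k : Fin n) : Measurable (residual θ k) := by
  have h : Measurable fun r : (Vec n × Vec n) × Fin K =>
      (r.1.2 - ((θ r.2).1.toEuclideanLin r.1.1 + (θ r.2).2)) k := by
    refine measurable_from_prod_countable_left fun j => ?_
    have hlin : Measurable fun x : Vec n => (θ j).1.toEuclideanLin x :=
      (LinearMap.continuous_of_finiteDimensional _).measurable
    change Measurable fun r : Vec n × Vec n => (r.2 - ((θ j).1.toEuclideanLin r.1 + (θ j).2)) k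
    fun_prop
  exact h.comp (f := fun r : Vec n × Vec n × Fin K => ((r.1, r.2.1), r.2.2)) (by fun_prop)

/-- Both models draw the state with the same weights, so the state contributes nothing to the
likelihood ratio. Given the state, the outputs differ by a shift of coordinate `k`, the only noisy
one, and the Gaussian shift formula applies. -/
theorem lintegral_tilt_outcome (hK : 1 ≤ K) (θ : Param n K) (k : Fin n) {v : ℝ≥0} (hv : v ≠ 0)
    (z : Vec n) (δ : ℝ) (i : Fin K) (x : Vec n) {F : Vec n × Fin K → ℝ≥0∞} (hF : Measurable F) :
    ∫⁻ r, F r ∂(gaussianModel hK (tilt θ k z δ) k v).outcome (i, x) =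
      ∫⁻ r, F r * ENNReal.ofReal (Real.exp (residual θ k (x, r) * (δ * (x k - z k)) / v -
        (δ * (x k - z k)) ^ 2 / v / 2)) ∂(gaussianModel hK θ k v).outcome (i, x) := by
  have hres := measurable_residual θ k
  have hsingle := measurable_single k
  rw [lintegral_gaussianModel_outcome hK _ k v i x hF,
    lintegral_gaussianModel_outcome hK _ k v i x (by fun_prop)]
  refine Finset.sum_congr rfl fun j _ => ?_
  congr 1
  have h := lintegral_gaussianReal_shift hv (δ * (x k - z k)) (F := fun g =>
    F ((θ j).1.toEuclideanLin x + (θ j).2 + EuclideanSpace.single k g, j)) (by fun_prop)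
  simp only [residual, add_sub_cancel_left, PiLp.single_apply, if_true]
  rw [← h]
  refine lintegral_congr fun g => ?_
  rw [tilt_mean]
  congr 2
  ext l
  by_cases hl : l = k
  · subst hl
    simp
    ring
  · simp [hl]

/-- In every state the residual is the same centred Gaussian of variance `v`, so the cross term
vanishes. This is the orthogonality of martingale increments, one step at a time. -/
theorem lintegral_sq_add_residual (hK : 1 ≤ K) (θ : Param n K) (k : Fin n) {v : ℝ≥0} (hv : v ≠ 0)
    (i : Fin K) (x : Vec n) (a d : ℝ) :
    ∫⁻ r, ENNReal.ofReal ((a + residual θ k (x, r) * d / v) ^ 2)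
        ∂(gaussianModel hK θ k v).outcome (i, x) =
      ENNReal.ofReal (a ^ 2) + ENNReal.ofReal (d ^ 2 / v) := by
  have hres := measurable_residual θ k
  have hv0 : (v : ℝ) ≠ 0 := by exact_mod_cast hv
  have hK0 : (K : ℝ) ≠ 0 := by
    have : K ≠ 0 := by omega
    exact_mod_cast this
  rw [lintegral_gaussianModel_outcome hK _ k v i x (by fun_prop)]
  simp only [residual, add_sub_cancel_left, PiLp.single_apply, if_true, mul_div_assoc,
    lintegral_sq_add_gaussianReal]
  have h : (d / v) ^ 2 * v = d ^ 2 / v := by field_simp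
  rw [h, Finset.sum_const, nsmul_eq_mul, ← mul_assoc, Finset.card_univ, Fintype.card_fin]
  have h2 : (K : ℝ≥0∞) * ENNReal.ofReal (1 / K) = 1 := by
    rw [← ENNReal.ofReal_natCast, ← ENNReal.ofReal_mul (by positivity), mul_one_div_cancel hK0,
      ENNReal.ofReal_one]
  rw [h2, one_mul]

/-! ### Likelihood ratios on histories -/

/-- The martingale part of the log-likelihood ratio of `tilt θ k z δ` against `θ`. -/
noncomputable def logMart (θ : Param n K) (k : Fin n) (v : ℝ≥0) (z : Vec n) (δ : ℝ) (t : ℕ)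
    (h : History n K t) : ℝ :=
  ∑ i, residual θ k (h.2 i) * (δ * ((h.2 i).1 k - z k)) / v

/-- The quadratic variation of `logMart`. -/
noncomputable def quadVar (k : Fin n) (v : ℝ≥0) (z : Vec n) (δ : ℝ) (t : ℕ)
    (h : History n K t) : ℝ :=
  ∑ i, (δ * ((h.2 i).1 k - z k)) ^ 2 / v

theorem measurable_logMart (θ : Param n K) (k : Fin n) (v : ℝ≥0) (z : Vec n) (δ : ℝ) (t : ℕ) :
    Measurable (logMart θ k v z δ t) := by
  have hres := measurable_residual θ k
  unfold logMart
  fun_prop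

theorem measurable_quadVar (k : Fin n) (v : ℝ≥0) (z : Vec n) (δ : ℝ) (t : ℕ) :
    Measurable (quadVar (K := K) k v z δ t) := by
  unfold quadVar
  fun_prop

theorem quadVar_nonneg (k : Fin n) (v : ℝ≥0) (z : Vec n) (δ : ℝ) (t : ℕ) (h : History n K t) :
    0 ≤ quadVar k v z δ t h :=
  Finset.sum_nonneg fun _ _ => by positivity

theorem logMart_extend (θ : Param n K) (k : Fin n) (v : ℝ≥0) (z : Vec n) (δ : ℝ) (t : ℕ)
    (h : History n K t) (x : Vec n) (r : Vec n × Fin K) :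
    logMart θ k v z δ (t + 1) (History.extend ((h, x), r)) =
      logMart θ k v z δ t h + residual θ k (x, r) * (δ * (x k - z k)) / v := by
  simp [logMart, History.extend, Fin.sum_univ_castSucc]

theorem quadVar_extend (k : Fin n) (v : ℝ≥0) (z : Vec n) (δ : ℝ) (t : ℕ)
    (h : History n K t) (x : Vec n) (r : Vec n × Fin K) :
    quadVar k v z δ (t + 1) (History.extend ((h, x), r)) =
      quadVar k v z δ t h + (δ * (x k - z k)) ^ 2 / v := by
  simp [quadVar, History.extend, Fin.sum_univ_castSucc]

theorem lintegral_law_succ (m : Model n K) (init : ProbabilityMeasure (Fin K)) (μ : Policy n K)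
    (t : ℕ) {F : History n K (t + 1) → ℝ≥0∞} (hF : Measurable F) :
    ∫⁻ h, F h ∂law m init μ (t + 1) =
      ∫⁻ h, ∫⁻ x, ∫⁻ r, F (History.extend ((h, x), r)) ∂m.outcome (History.last t h, x)
        ∂μ.rule t h ∂law m init μ t := by
  have hG := hF.comp (History.measurable_extend (n := n) (K := K) (t := t))
  rw [law, lintegral_map hF History.measurable_extend,
    Measure.lintegral_compProd (f := fun p => F (History.extend p)) hG,
    Measure.lintegral_compProd]
  · rfl
  · exact hG.lintegral_kernel_prod_right'

theorem measurable_lintegral_outcome (m : Model n K) (t : ℕ)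
    {G : (History n K t × Vec n) × (Vec n × Fin K) → ℝ≥0∞} (hG : Measurable G) :
    Measurable fun p : History n K t × Vec n =>
      ∫⁻ r, G (p, r) ∂m.outcome (History.last t p.1, p.2) :=
  hG.lintegral_kernel_prod_right' (κ := m.outcome.comap
    (fun p : History n K t × Vec n => (History.last t p.1, p.2))
    (((History.measurable_last t).comp measurable_fst).prodMk measurable_snd))

/-- The one-step densities multiply along the history. The initial law and the policy kernels do not
depend on the model, hence contribute no factor; the density of the past is a finite constant for
the next step and passes through its integrals. -/
theorem lintegral_law_tilt (hK : 1 ≤ K) (θ : Param n K) (k : Fin n) {v : ℝ≥0} (hv : v ≠ 0)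
    (z : Vec n) (δ : ℝ) (init : ProbabilityMeasure (Fin K)) (μ : Policy n K) (t : ℕ) :
    ∀ {F : History n K t → ℝ≥0∞}, Measurable F →
      ∫⁻ h, F h ∂law (gaussianModel hK (tilt θ k z δ) k v) init μ t =
        ∫⁻ h, F h * ENNReal.ofReal (Real.exp (logMart θ k v z δ t h - quadVar k v z δ t h / 2))
          ∂law (gaussianModel hK θ k v) init μ t := by
  induction t with
  | zero =>
    intro F _
    simp [logMart, quadVar, law]
  | succ t ih =>
    intro F hF
    have hM := measurable_logMart θ k v z δ
    have hV := measurable_quadVar (K := K) k v z δ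
    have hres := measurable_residual θ k
    have hext := History.measurable_extend (n := n) (K := K) (t := t)
    rw [lintegral_law_succ _ _ _ _ hF, lintegral_law_succ _ _ _ _ (by fun_prop), ih]
    · refine lintegral_congr fun h => ?_
      rw [← lintegral_mul_const']
      · refine lintegral_congr fun x => ?_
        rw [lintegral_tilt_outcome hK θ k hv z δ _ _
          (F := fun r => F (History.extend ((h, x), r))) (by fun_prop), ← lintegral_mul_const']
        · refine lintegral_congr fun r => ?_
          rw [logMart_extend, quadVar_extend, mul_assoc, ← ENNReal.ofReal_mul (by positivity),
            ← Real.exp_add]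
          congr 3
          ring
        · exact ENNReal.ofReal_ne_top
      · exact ENNReal.ofReal_ne_top
    · exact (measurable_lintegral_outcome _ t (G := fun p => F (History.extend p))
        (hF.comp hext)).lintegral_kernel_prod_right'

/-- Itô isometry in discrete time: given the past and the input, each increment is centred with
variance equal to the increment of `quadVar`. -/
theorem lintegral_logMart_sq (hK : 1 ≤ K) (θ : Param n K) (k : Fin n) {v : ℝ≥0} (hv : v ≠ 0)
    (z : Vec n) (δ : ℝ) (init : ProbabilityMeasure (Fin K)) (μ : Policy n K) (t : ℕ) :
    ∫⁻ h, ENNReal.ofReal (logMart θ k v z δ t h ^ 2) ∂law (gaussianModel hK θ k v) init μ t =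
      ∫⁻ h, ENNReal.ofReal (quadVar k v z δ t h) ∂law (gaussianModel hK θ k v) init μ t := by
  induction t with
  | zero => simp [logMart, quadVar]
  | succ t ih =>
    have hM := measurable_logMart θ k v z δ
    have hV := measurable_quadVar (K := K) k v z δ
    rw [lintegral_law_succ _ _ _ _ (by fun_prop), lintegral_law_succ _ _ _ _ (by fun_prop)]
    simp only [logMart_extend, quadVar_extend, lintegral_sq_add_residual hK θ k hv]
    have hpos : ∀ x : Vec n, 0 ≤ (δ * (x k - z k)) ^ 2 / (v : ℝ) := fun x => by positivity
    simp only [ENNReal.ofReal_add (quadVar_nonneg k v z δ t _) (hpos _), lintegral_const,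
      measure_univ, mul_one]
    simp only [lintegral_add_left measurable_const, lintegral_const, measure_univ, mul_one]
    rw [lintegral_add_left (by fun_prop), lintegral_add_left (by fun_prop), ih]

/-- The information `E (V_T)` is at most `δ² / v` times the input-MSE about `z`. -/
theorem lintegral_quadVar_le (m : Model n K) (k : Fin n) (v : ℝ≥0) (z : Vec n) (δ : ℝ)
    (init : ProbabilityMeasure (Fin K)) (μ : Policy n K) (hz : ∀ i, optInput m.θ m.P i = z)
    (t : ℕ) :
    ∫⁻ h, ENNReal.ofReal (quadVar k v z δ t h) ∂law m init μ t ≤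
      ENNReal.ofReal (δ ^ 2 / v) * cumMSE m init μ μ t := by
  induction t with
  | zero => simp [quadVar]
  | succ t ih =>
    have hV := measurable_quadVar (K := K) k v z δ
    have hpos : ∀ x : Vec n, 0 ≤ (δ * (x k - z k)) ^ 2 / (v : ℝ) := fun x => by positivity
    rw [lintegral_law_succ _ _ _ _ (by fun_prop)]
    simp only [quadVar_extend, ENNReal.ofReal_add (quadVar_nonneg k v z δ t _) (hpos _),
      lintegral_const, measure_univ, mul_one]
    simp only [lintegral_add_left measurable_const, lintegral_const, measure_univ, mul_one]
    rw [lintegral_add_left (by fun_prop), cumMSE, Finset.sum_range_succ, mul_add]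
    refine add_le_add ih ?_
    rw [← lintegral_const_mul' _ _ ENNReal.ofReal_ne_top]
    refine lintegral_mono fun h => ?_
    dsimp only
    rw [← lintegral_const_mul' _ _ ENNReal.ofReal_ne_top]
    refine lintegral_mono fun x => ?_
    dsimp only
    -- All states share the optimal input `z`, so the error in `cumMSE` is measured from the very
    -- point about which the information is centred.
    rw [← ENNReal.ofReal_mul (by positivity), hz]
    refine ENNReal.ofReal_le_ofReal ?_
    have h1 : (x k - z k) ^ 2 ≤ ‖x - z‖ ^ 2 := by
      have := PiLp.norm_apply_le (x - z) k
      rw [← sq_abs (x k - z k)]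
      exact pow_le_pow_left₀ (abs_nonneg _) this 2
    calc (δ * (x k - z k)) ^ 2 / (v : ℝ) = δ ^ 2 / v * (x k - z k) ^ 2 := by ring
      _ ≤ _ := mul_le_mul_of_nonneg_left h1 (by positivity)

/-- From `exp u ≥ 1 + u` and `a² + a + 1/4 ≥ 0`. It bounds the overlap of the two laws using only
the second moment of the martingale and the mean of its quadratic variation. -/
theorem le_min_one_exp (a b : ℝ) (hb : 0 ≤ b) :
    3 / 4 - (a ^ 2 + b / 2) ≤ min 1 (Real.exp (a - b / 2)) := by
  refine le_min ?_ ?_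
  · nlinarith [sq_nonneg a]
  · have := Real.add_one_le_exp (a - b / 2)
    nlinarith [sq_nonneg (a + 1 / 2)]

/-- Le Cam's two-point bound for a single time step. -/
theorem two_point_step (hK : 1 ≤ K) (θ : Param n K) (k : Fin n) {v : ℝ≥0} (hv : v ≠ 0)
    (z : Vec n) (δ : ℝ) (init : ProbabilityMeasure (Fin K)) (μ : Policy n K) (t : ℕ)
    {f g : History n K t → ℝ≥0∞} (hf : Measurable f) (hg : Measurable g) {c : ℝ} (hc : 0 ≤ c)
    (hfg : ∀ h, ENNReal.ofReal c ≤ f h + g h)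
    (hV : ∫⁻ h, ENNReal.ofReal (quadVar k v z δ t h) ∂law (gaussianModel hK θ k v) init μ t ≤
      ENNReal.ofReal (1 / 4)) :
    ENNReal.ofReal (3 / 8 * c) ≤ ∫⁻ h, f h ∂law (gaussianModel hK θ k v) init μ t +
      ∫⁻ h, g h ∂law (gaussianModel hK (tilt θ k z δ) k v) init μ t := by
  have hmM := measurable_logMart θ k v z δ t
  have hmV := measurable_quadVar (K := K) k v z δ t
  set Q := law (gaussianModel hK θ k v) init μ t with hQ
  set A : History n K t → ℝ := fun h => logMart θ k v z δ t h ^ 2 + quadVar k v z δ t h / 2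
  have hAm : Measurable A := by fun_prop
  -- By the isometry the mean of `A` is `3/2` times that of `quadVar`, which is at most `1/4`.
  have hA : ∫⁻ h, ENNReal.ofReal (A h) ∂Q ≤ ENNReal.ofReal (3 / 8) := by
    have h1 : ∀ h, ENNReal.ofReal (A h) = ENNReal.ofReal (logMart θ k v z δ t h ^ 2) +
        ENNReal.ofReal (1 / 2) * ENNReal.ofReal (quadVar k v z δ t h) := fun h => by
      rw [← ENNReal.ofReal_mul (by positivity), ← ENNReal.ofReal_add (by positivity)
        (mul_nonneg (by positivity) (quadVar_nonneg k v z δ t h))]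
      congr 1
      simp only [A]
      ring
    simp only [h1]
    rw [lintegral_add_left (by fun_prop), lintegral_const_mul _ (by fun_prop), hQ,
      lintegral_logMart_sq hK θ k hv]
    refine (add_le_add hV (mul_le_mul_right hV _)).trans ?_
    rw [← ENNReal.ofReal_mul (by positivity), ← ENNReal.ofReal_add (by positivity)
      (by positivity)]
    exact ENNReal.ofReal_le_ofReal (by norm_num)
  rw [lintegral_law_tilt hK θ k hv z δ init μ t hg, ← lintegral_add_left hf]
  -- With `L` the likelihood ratio, `f + g L ≥ (f + g) min(1, L) ≥ c (3/4 - A)`. The term with `A`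
  -- is kept on the right to avoid truncated subtraction.
  have h2 : ENNReal.ofReal (3 / 4 * c) ≤ ∫⁻ h, (f h + g h *
      ENNReal.ofReal (Real.exp (logMart θ k v z δ t h - quadVar k v z δ t h / 2))) ∂Q +
      ENNReal.ofReal c * ∫⁻ h, ENNReal.ofReal (A h) ∂Q := by
    rw [← lintegral_const_mul' _ _ ENNReal.ofReal_ne_top, ← lintegral_add_right _ (by fun_prop)]
    calc ENNReal.ofReal (3 / 4 * c) = ∫⁻ _, ENNReal.ofReal (3 / 4 * c) ∂Q := by simp
      _ ≤ _ := lintegral_mono fun h => ?_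
    dsimp only
    set b := min 1 (Real.exp (logMart θ k v z δ t h - quadVar k v z δ t h / 2)) with hb
    have hb0 : 0 ≤ b := le_min zero_le_one (Real.exp_pos _).le
    have hA0 : 0 ≤ A h :=
      add_nonneg (sq_nonneg _) (div_nonneg (quadVar_nonneg k v z δ t h) (by norm_num))
    have h3 : 3 / 4 ≤ b + A h := by
      have := le_min_one_exp (logMart θ k v z δ t h) _ (quadVar_nonneg k v z δ t h)
      simp only [A]
      linarith
    have h4 : ENNReal.ofReal c * ENNReal.ofReal b ≤ f h + g h *
        ENNReal.ofReal (Real.exp (logMart θ k v z δ t h - quadVar k v z δ t h / 2)) := by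
      refine (mul_le_mul_left (hfg h) _).trans ?_
      rw [add_mul]
      refine add_le_add ?_ (mul_le_mul_right (ENNReal.ofReal_le_ofReal (min_le_right _ _)) _)
      refine (mul_le_mul_right (ENNReal.ofReal_le_one.2 (min_le_left _ _)) _).trans ?_
      rw [mul_one]
    refine le_trans ?_ (add_le_add_left h4 _)
    rw [← ENNReal.ofReal_mul hc, ← ENNReal.ofReal_mul hc, ← ENNReal.ofReal_add (by positivity)
      (by positivity)]
    refine ENNReal.ofReal_le_ofReal ?_
    nlinarith
  have h5 : ENNReal.ofReal c * ∫⁻ h, ENNReal.ofReal (A h) ∂Q ≤ ENNReal.ofReal (3 / 8 * c) := by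
    refine (mul_le_mul_right hA _).trans ?_
    rw [← ENNReal.ofReal_mul hc, mul_comm]
  refine ENNReal.le_of_add_le_add_right (a := ENNReal.ofReal (3 / 8 * c))
    ENNReal.ofReal_ne_top ?_
  rw [← ENNReal.ofReal_add (by positivity) (by positivity)]
  refine le_trans ?_ (h2.trans (add_le_add_right h5 _))
  exact ENNReal.ofReal_le_ofReal (by linarith)

/-! ### Optimal inputs -/

theorem inner_transpose_toEuclideanLin (B : Matrix (Fin n) (Fin n) ℝ) (a c : Vec n) :
    inner ℝ a (B.transpose.toEuclideanLin c) = inner ℝ c (B.toEuclideanLin a) := by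
  have h := Matrix.toEuclideanLin_conjTranspose_eq_adjoint B
  rw [Matrix.conjTranspose_eq_transpose_of_trivial] at h
  rw [h, LinearMap.adjoint_inner_right, real_inner_comm]

theorem inner_sum_symm_toEuclideanLin (θ : Param n K) (p : Fin K → ℝ) (a c : Vec n) :
    inner ℝ a ((∑ j, p j • ((θ j).1 + (θ j).1.transpose)).toEuclideanLin c) = ∑ j, p j *
      (inner ℝ a ((θ j).1.toEuclideanLin c) + inner ℝ c ((θ j).1.toEuclideanLin a)) := by
  simp only [map_sum, map_smul, map_add, LinearMap.sum_apply, LinearMap.smul_apply,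
    LinearMap.add_apply, inner_sum, inner_smul_right, inner_add_right,
    inner_transpose_toEuclideanLin]

/-- The first-order condition for the optimal input. -/
theorem optInput_stationary {θ : Param n K} (hneg : ∀ k, NegDef (θ k).1)
    {P : Matrix (Fin K) (Fin K) ℝ} (hP : P ∈ Matrix.rowStochastic ℝ (Fin K)) (i : Fin K) :
    (∑ j, P i j • ((θ j).1 + (θ j).1.transpose)).toEuclideanLin (optInput θ P i) +
      ∑ j, P i j • (θ j).2 = 0 := by
  have hP0 := (Matrix.mem_rowStochastic.1 hP).1 i
  have hP1 : ∑ j, P i j = 1 := by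
    simpa [Matrix.mulVec, dotProduct] using congrFun (Matrix.mem_rowStochastic.1 hP).2 i
  set S := ∑ j, P i j • ((θ j).1 + (θ j).1.transpose) with hS
  have hunit : IsUnit S := by
    rw [← Matrix.mulVec_injective_iff_isUnit]
    refine (injective_iff_map_eq_zero (Matrix.mulVecLin S)).2 fun a ha => ?_
    by_contra hne
    have hne' : (WithLp.toLp 2 a : Vec n) ≠ 0 := fun h => hne (by simpa using h)
    have h0 : S.toEuclideanLin (WithLp.toLp 2 a) = 0 := by
      rw [Matrix.mulVecLin_apply] at ha
      simp [Matrix.toLpLin_toLp, ha]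
    have h1 := inner_sum_symm_toEuclideanLin θ (P i) (WithLp.toLp 2 a) (WithLp.toLp 2 a)
    rw [← hS, h0, inner_zero_right] at h1
    obtain ⟨j, hj⟩ : ∃ j, 0 < P i j := by
      by_contra! hcon
      have := Finset.sum_nonpos fun j (_ : j ∈ Finset.univ) => hcon j
      linarith
    have h2 : ∑ j, P i j * (inner ℝ (WithLp.toLp 2 a : Vec n)
        ((θ j).1.toEuclideanLin (WithLp.toLp 2 a)) + inner ℝ (WithLp.toLp 2 a : Vec n)
        ((θ j).1.toEuclideanLin (WithLp.toLp 2 a))) < 0 := by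
      refine Finset.sum_neg' (fun k _ => ?_) ⟨j, Finset.mem_univ j, ?_⟩
      · exact mul_nonpos_of_nonneg_of_nonpos (hP0 k) (add_neg (hneg k _ hne') (hneg k _ hne')).le
      · exact mul_neg_of_pos_of_neg hj (add_neg (hneg j _ hne') (hneg j _ hne'))
    linarith
  have hmul : S * S⁻¹ = 1 := Matrix.mul_nonsing_inv S ((Matrix.isUnit_iff_isUnit_det S).1 hunit)
  have hcomp : ∀ v : Vec n, S.toEuclideanLin (S⁻¹.toEuclideanLin v) = v := fun v => by
    ext k
    simp [Matrix.toLpLin_apply, Matrix.mulVec_mulVec, hmul]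
  rw [optInput, map_neg, ← hS, hcomp, neg_add_cancel]

/-- The excess stage cost is the quadratic form of `-∑_j p_{ij} A_j` at `x - x*_i`. -/
theorem stageCost_sub_stageCost_optInput (m : Model n K)
    (hint : ∀ k, Integrable (fun w => w) (m.noise k : Measure (Vec n)))
    (hmean : ∀ k, ∫ w, w ∂(m.noise k : Measure (Vec n)) = 0)
    (hneg : ∀ k, NegDef (m.θ k).1) (i : Fin K) (x : Vec n) :
    m.stageCost i x - m.stageCost i (optInput m.θ m.P i) =
      -∑ j, m.P i j * inner ℝ (x - optInput m.θ m.P i)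
        ((m.θ j).1.toEuclideanLin (x - optInput m.θ m.P i)) := by
  rw [m.stageCost_eq hint hmean, m.stageCost_eq hint hmean]
  have hfoc := optInput_stationary hneg m.stochastic i
  set z := optInput m.θ m.P i
  have key : ∑ j, m.P i j * inner ℝ x ((m.θ j).1.toEuclideanLin x + (m.θ j).2) -
      ∑ j, m.P i j * inner ℝ z ((m.θ j).1.toEuclideanLin z + (m.θ j).2) =
      inner ℝ (x - z) ((∑ j, m.P i j • ((m.θ j).1 + (m.θ j).1.transpose)).toEuclideanLin z +
        ∑ j, m.P i j • (m.θ j).2) +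
        ∑ j, m.P i j * inner ℝ (x - z) ((m.θ j).1.toEuclideanLin (x - z)) := by
    rw [inner_add_right, inner_sum_symm_toEuclideanLin, inner_sum, ← Finset.sum_sub_distrib,
      ← Finset.sum_add_distrib, ← Finset.sum_add_distrib]
    refine Finset.sum_congr rfl fun j _ => ?_
    simp only [map_sub, inner_sub_left, inner_sub_right, inner_add_right, inner_smul_right]
    ring
  rw [hfoc, inner_zero_right, zero_add] at key
  linarith

/-- On a compact parameter set, negative definiteness is uniform. -/
theorem exists_uniform_negDef {Θ : Set (Param n K)} (hΘ : IsCompact Θ)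
    (hneg : ∀ θ ∈ Θ, ∀ k, NegDef (θ k).1) :
    ∃ c : ℝ, 0 < c ∧ ∀ θ ∈ Θ, ∀ k, ∀ x : Vec n,
      inner ℝ x ((θ k).1.toEuclideanLin x) ≤ -c * ‖x‖ ^ 2 := by
  have hcont : ∀ k : Fin K, Continuous fun p : Param n K × Vec n =>
      inner ℝ p.2 ((p.1 k).1.toEuclideanLin p.2) := fun k => by
    have h : Continuous fun p : Param n K × Vec n => (p.1 k).1.toEuclideanLin p.2 := by
      simp only [Matrix.toLpLin_apply]
      refine (PiLp.continuous_toLp 2 _).comp ?_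
      exact Continuous.matrix_mulVec (by fun_prop) (by fun_prop)
    exact continuous_snd.inner h
  have hunif : ∀ k : Fin K, ∃ c : ℝ, 0 < c ∧ ∀ θ ∈ Θ, ∀ x : Vec n, ‖x‖ = 1 →
      inner ℝ x ((θ k).1.toEuclideanLin x) ≤ -c := fun k => by
    have hcomp : IsCompact (Θ ×ˢ Metric.sphere (0 : Vec n) 1) := hΘ.prod (isCompact_sphere 0 1)
    -- The set can be empty, for instance if `n = 0`; any positive constant then works.
    rcases (Θ ×ˢ Metric.sphere (0 : Vec n) 1).eq_empty_or_nonempty with he | hne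
    · refine ⟨1, one_pos, fun θ hθ x hx => ?_⟩
      have : (θ, x) ∈ Θ ×ˢ Metric.sphere (0 : Vec n) 1 := ⟨hθ, by simpa using hx⟩
      rw [he] at this
      exact this.elim
    · obtain ⟨p, hp, hmax⟩ := hcomp.exists_isMaxOn hne (hcont k).continuousOn
      refine ⟨-inner ℝ p.2 ((p.1 k).1.toEuclideanLin p.2), ?_, fun θ hθ x hx => ?_⟩
      · have hp2 : p.2 ≠ 0 := fun h => by simpa [h] using hp.2
        have := hneg p.1 hp.1 k p.2 hp2
        linarith
      · have := hmax (show (θ, x) ∈ _ from ⟨hθ, by simpa using hx⟩)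
        simpa using this
  choose c hc0 hc using hunif
  obtain ⟨d, hd0, hd⟩ : ∃ d : ℝ, 0 < d ∧ ∀ k, d ≤ c k := by
    rcases isEmpty_or_nonempty (Fin K) with h | h
    · exact ⟨1, one_pos, fun k => h.elim k⟩
    · obtain ⟨k, hk⟩ := Finite.exists_min c
      exact ⟨c k, hc0 k, hk⟩
  refine ⟨d, hd0, fun θ hθ k x => ?_⟩
  by_cases hx : x = 0
  · simp [hx]
  have hx0 : 0 < ‖x‖ := norm_pos_iff.2 hx
  have h1 := hc k θ hθ (‖x‖⁻¹ • x) (by rw [norm_smul, norm_inv, norm_norm, inv_mul_cancel₀ hx0.ne'])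
  rw [map_smul, inner_smul_left, inner_smul_right, conj_trivial] at h1
  have h2 := h1.trans (neg_le_neg (hd k))
  have h3 : inner ℝ x ((θ k).1.toEuclideanLin x) = ‖x‖ ^ 2 * (‖x‖⁻¹ * (‖x‖⁻¹ *
      inner ℝ x ((θ k).1.toEuclideanLin x))) := by field_simp
  rw [h3]
  nlinarith [sq_nonneg ‖x‖]

/-- Tilting moves the optimal input by at least a multiple of `δ`. -/
theorem exists_le_norm_optInput_tilt_sub (hK : 1 ≤ K) {θ : Param n K}
    (hneg : ∀ k, NegDef (θ k).1) {k : Fin n} (i : Fin K) {z : Vec n}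
    (hz : z = optInput θ (uniformTransition K) i) (hzk : z k ≠ 0) :
    ∃ c : ℝ, 0 < c ∧ ∀ δ : ℝ, 0 ≤ δ → δ ≤ 1 → (∀ j, NegDef (tilt θ k z δ j).1) →
      c * δ ≤ ‖z - optInput (tilt θ k z δ) (uniformTransition K) i‖ := by
  have hK0 : (K : ℝ) ≠ 0 := by
    have : K ≠ 0 := by omega
    exact_mod_cast this
  set S := ∑ j, uniformTransition K i j • ((θ j).1 + (θ j).1.transpose) with hS
  set N := ‖LinearMap.toContinuousLinearMap S.toEuclideanLin‖ with hN
  have hN0 : 0 ≤ N := norm_nonneg _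
  -- Subtracting the two first-order conditions gives `δ z_k e_k = S (z - x) + 2 δ (z_k - x_k) e_k`.
  -- For `δ ≤ 1` the right side has norm at most `(N + 2) ‖z - x‖`.
  refine ⟨|z k| / (N + 2), div_pos (abs_pos.2 hzk) (by positivity), fun δ hδ0 hδ1 hnegδ => ?_⟩
  set x := optInput (tilt θ k z δ) (uniformTransition K) i with hx
  have h0 := optInput_stationary hneg (uniformTransition_stochastic hK) i
  have h1 := optInput_stationary hnegδ (uniformTransition_stochastic hK) i
  rw [← hz, ← hS] at h0
  rw [← hx] at h1
  have hSδ : ∑ j, uniformTransition K i j • ((tilt θ k z δ j).1 + (tilt θ k z δ j).1.transpose) =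
      S + (2 * δ) • Matrix.single k k 1 := by
    have : ∀ j, uniformTransition K i j •
        ((tilt θ k z δ j).1 + (tilt θ k z δ j).1.transpose) =
        uniformTransition K i j • ((θ j).1 + (θ j).1.transpose) +
          (1 / (K : ℝ)) • (2 * δ) • Matrix.single k k 1 := fun j => by
      simp only [tilt, Matrix.transpose_add, Matrix.transpose_smul, Matrix.transpose_single,
        uniformTransition, Matrix.of_apply]
      module
    simp only [this, Finset.sum_add_distrib, ← hS, Finset.sum_const, Finset.card_univ,
      Fintype.card_fin, ← Nat.cast_smul_eq_nsmul ℝ, smul_smul]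
    congr 2
    field_simp
  have hbδ : ∑ j, uniformTransition K i j • (tilt θ k z δ j).2 =
      ∑ j, uniformTransition K i j • (θ j).2 - EuclideanSpace.single k (δ * z k) := by
    simp only [tilt, smul_sub, Finset.sum_sub_distrib]
    congr 1
    simp only [uniformTransition, Matrix.of_apply, Finset.sum_const, Finset.card_univ,
      Fintype.card_fin, ← Nat.cast_smul_eq_nsmul ℝ, smul_smul]
    rw [mul_one_div_cancel hK0, one_smul]
  rw [hSδ, hbδ, map_add, map_smul, LinearMap.add_apply, LinearMap.smul_apply,
    toEuclideanLin_single, ← smul_eq_mul δ, single_eq_smul, single_eq_smul k (δ • z k)] at h1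
  have h2 : (δ * z k) • (EuclideanSpace.single k 1 : Vec n) =
      S.toEuclideanLin (z - x) + (2 * δ * (z k - x k)) • EuclideanSpace.single k 1 := by
    rw [smul_eq_mul] at h1
    rw [map_sub]
    linear_combination (norm := module) h1 - h0
  have h4 : δ * |z k| ≤ (N + 2) * ‖z - x‖ := by
    have h5 := congrArg norm h2
    rw [norm_smul, Real.norm_eq_abs, abs_mul, abs_of_nonneg hδ0, PiLp.norm_single,
      norm_one, mul_one] at h5
    have h6 : ‖S.toEuclideanLin (z - x)‖ ≤ N * ‖z - x‖ :=
      (LinearMap.toContinuousLinearMap S.toEuclideanLin).le_opNorm _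
    have h7 : |z k - x k| ≤ ‖z - x‖ := PiLp.norm_apply_le (z - x) k
    have h8 := norm_add_le (S.toEuclideanLin (z - x))
      ((2 * δ * (z k - x k)) • (EuclideanSpace.single k 1 : Vec n))
    rw [norm_smul, Real.norm_eq_abs, abs_mul, PiLp.norm_single, norm_one, mul_one,
      abs_of_nonneg (by positivity : 0 ≤ 2 * δ)] at h8
    nlinarith [abs_nonneg (z k - x k)]
  rw [div_mul_eq_mul_div, div_le_iff₀ (by positivity)]
  linarith

/-! ### The hard family of models -/

theorem continuous_tilt (θ : Param n K) (k : Fin n) (z : Vec n) : Continuous (tilt θ k z) := by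
  have h := (continuous_single k).comp (continuous_mul_const (z k))
  refine continuous_pi fun j => Continuous.prodMk ?_ ?_
  · exact continuous_const.add (continuous_id.smul continuous_const)
  · exact continuous_const.sub h

theorem exists_Icc_subset_of_isOpen {X : Type*} [TopologicalSpace X] {U : Set X} (hU : IsOpen U)
    {f : ℝ → X} (hf : Continuous f) (h0 : f 0 ∈ U) :
    ∃ ε : ℝ, 0 < ε ∧ ε ≤ 1 ∧ ∀ δ, 0 ≤ δ → δ ≤ ε → f δ ∈ U := by
  obtain ⟨ε, hε, hball⟩ := Metric.isOpen_iff.1 (hU.preimage hf) 0 h0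
  -- Halving keeps the closed endpoint inside the open ball; the cap at `1` serves the hypothesis `δ
  -- ≤ 1` on tilts.
  refine ⟨min (ε / 2) 1, by positivity, min_le_right _ _, fun δ hδ0 hδ => hball ?_⟩
  have := hδ.trans (min_le_left _ _)
  rw [Metric.mem_ball, Real.dist_eq, sub_zero, abs_of_nonneg hδ0]
  linarith

/-- Some interior parameter has a non-zero optimal input. -/
theorem exists_optInput_ne_zero (hn : 1 ≤ n) (hK : 1 ≤ K) {U : Set (Param n K)} (hU : IsOpen U)
    (hne : U.Nonempty) (hneg : ∀ θ ∈ U, ∀ k, NegDef (θ k).1) (i : Fin K) :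
    ∃ θ ∈ U, optInput θ (uniformTransition K) i ≠ 0 := by
  obtain ⟨θ, hθ⟩ := hne
  by_cases hz : optInput θ (uniformTransition K) i = 0
  swap
  · exact ⟨θ, hθ, hz⟩
  set e : Vec n := EuclideanSpace.single ⟨0, hn⟩ 1 with he
  -- If the optimal input is zero, the averaged offset is zero. Shifting every offset by the same
  -- small vector makes that average non-zero, and with it the optimal input.
  set f : ℝ → Param n K := fun τ j => ((θ j).1, (θ j).2 + τ • e) with hf
  obtain ⟨ε, hε, -, hεU⟩ := exists_Icc_subset_of_isOpen hU (f := f) (by fun_prop)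
    (by simpa [hf] using hθ)
  have hfU := hεU ε hε.le le_rfl
  refine ⟨f ε, hfU, fun hz' => ?_⟩
  have hP := uniformTransition_stochastic hK
  have h0 := optInput_stationary (hneg θ hθ) hP i
  have h1 := optInput_stationary (hneg _ hfU) hP i
  have hP1 : ∑ j, uniformTransition K i j = 1 := by
    simpa [Matrix.mulVec, dotProduct] using congrFun (Matrix.mem_rowStochastic.1 hP).2 i
  rw [hz, map_zero, zero_add] at h0
  rw [hz', map_zero, zero_add] at h1
  simp only [hf, smul_add, Finset.sum_add_distrib, h0, zero_add, ← Finset.sum_smul, hP1,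
    one_smul] at h1
  simp [hε.ne', he] at h1

/-- The rows of the uniform transition matrix coincide, so one `z` serves all previous states and
what is shown for the first state holds for every state by definition. -/
theorem exists_tilt_family (hn : 1 ≤ n) (hK : 1 ≤ K) {U : Set (Param n K)} (hU : IsOpen U)
    (hne : U.Nonempty) (hneg : ∀ θ ∈ U, ∀ k, NegDef (θ k).1) :
    ∃ (θ : Param n K) (k : Fin n) (z : Vec n) (δ₀ c : ℝ), 0 < δ₀ ∧ 0 < c ∧
      (∀ i, optInput θ (uniformTransition K) i = z) ∧
      ∀ δ, 0 ≤ δ → δ ≤ δ₀ → tilt θ k z δ ∈ U ∧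
        ∀ i, c * δ ≤ ‖z - optInput (tilt θ k z δ) (uniformTransition K) i‖ := by
  obtain ⟨θ, hθ, hz⟩ := exists_optInput_ne_zero hn hK hU hne hneg ⟨0, hK⟩
  set z := optInput θ (uniformTransition K) ⟨0, hK⟩ with hzdef
  obtain ⟨k, hk⟩ : ∃ k, z k ≠ 0 := by
    by_contra! h
    exact hz (by ext k; simpa using h k)
  obtain ⟨δ₀, hδ₀, hδ₀1, hmem⟩ := exists_Icc_subset_of_isOpen hU (continuous_tilt θ k z)
    (by simpa using hθ)
  obtain ⟨c, hc, hcu⟩ := exists_le_norm_optInput_tilt_sub hK (hneg θ hθ) ⟨0, hK⟩ hzdef hk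
  exact ⟨θ, k, z, δ₀, c, hδ₀, hc, fun _ => rfl, fun δ h0 h1 => ⟨hmem δ h0 h1, fun _ =>
    hcu δ h0 (h1.trans hδ₀1) (hneg _ (hmem δ h0 h1))⟩⟩

/-! ### From the two-point family to worst-case errors and regret -/

/-- The two-point bound for the cumulative estimation error, over the first `s` time steps. -/
theorem two_point_cumMSE (hK : 1 ≤ K) (θ : Param n K) (k : Fin n) {v : ℝ≥0} (hv : v ≠ 0)
    (z : Vec n) (hz : ∀ i, optInput θ (uniformTransition K) i = z) {δ b : ℝ} (hb : 0 ≤ b)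
    (hδ : ∀ i, b ≤ ‖z - optInput (tilt θ k z δ) (uniformTransition K) i‖)
    (init : ProbabilityMeasure (Fin K)) (μ : Policy n K) (r : Rules n K) {s T : ℕ} (hsT : s ≤ T)
    (hV : ∀ t < s, ∫⁻ h, ENNReal.ofReal (quadVar k v z δ t h)
      ∂law (gaussianModel hK θ k v) init μ t ≤ ENNReal.ofReal (1 / 4)) :
    ENNReal.ofReal (s * (3 / 16 * b ^ 2)) ≤ cumMSE (gaussianModel hK θ k v) init μ r T +
      cumMSE (gaussianModel hK (tilt θ k z δ) k v) init μ r T := by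
  have hstep : ∀ t ∈ Finset.range s, ENNReal.ofReal (3 / 16 * b ^ 2) ≤
      ∫⁻ h, ∫⁻ y, ENNReal.ofReal (‖y - optInput θ (uniformTransition K) (History.last t h)‖ ^ 2)
        ∂(r.rule t h) ∂(law (gaussianModel hK θ k v) init μ t) +
      ∫⁻ h, ∫⁻ y, ENNReal.ofReal
        (‖y - optInput (tilt θ k z δ) (uniformTransition K) (History.last t h)‖ ^ 2)
        ∂(r.rule t h) ∂(law (gaussianModel hK (tilt θ k z δ) k v) init μ t) := by
    intro t ht
    have hmeas : ∀ θ' : Param n K, Measurable fun h : History n K t => ∫⁻ y, ENNReal.ofReal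
        (‖y - optInput θ' (uniformTransition K) (History.last t h)‖ ^ 2) ∂(r.rule t h) := by
      intro θ'
      have h1 : Measurable fun h : History n K t =>
          optInput θ' (uniformTransition K) (History.last t h) :=
        (measurable_of_finite (optInput θ' (uniformTransition K))).comp
          (History.measurable_last t)
      refine Measurable.lintegral_kernel_prod_right' (f := fun p : History n K t × Vec n =>
        ENNReal.ofReal (‖p.2 - optInput θ' (uniformTransition K) (History.last t p.1)‖ ^ 2)) ?_
      have h2 : Measurable fun p : History n K t × Vec n =>
          optInput θ' (uniformTransition K) (History.last t p.1) := h1.comp measurable_fst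
      exact ((measurable_snd.sub h2).norm.pow_const 2).ennreal_ofReal
    -- Two targets at distance at least `b` force the squared errors of any estimate to add up to at
    -- least `b² / 2`.
    have h := two_point_step hK θ k hv z δ init μ t (hmeas θ) (hmeas (tilt θ k z δ))
      (c := b ^ 2 / 2) (by positivity) (fun h => ?_) (hV t (Finset.mem_range.1 ht))
    · refine le_trans (le_of_eq ?_) h
      congr 1
      ring
    · rw [← lintegral_add_left (by fun_prop)]
      calc ENNReal.ofReal (b ^ 2 / 2) = ∫⁻ _, ENNReal.ofReal (b ^ 2 / 2) ∂(r.rule t h) := by simp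
        _ ≤ _ := lintegral_mono fun y => ?_
      dsimp only
      rw [← ENNReal.ofReal_add (by positivity) (by positivity), hz]
      refine ENNReal.ofReal_le_ofReal ?_
      have h1 := hδ (History.last t h)
      set x := optInput (tilt θ k z δ) (uniformTransition K) (History.last t h)
      have h2 : ‖z - x‖ ≤ ‖y - z‖ + ‖y - x‖ := by
        rw [norm_sub_rev y z]
        exact norm_sub_le_norm_sub_add_norm_sub z y x
      nlinarith [sq_nonneg (‖y - z‖ - ‖y - x‖), norm_nonneg (y - z), norm_nonneg (y - x)]
  rw [cumMSE, cumMSE, ← Finset.sum_add_distrib]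
  calc ENNReal.ofReal (s * (3 / 16 * b ^ 2))
      = ∑ t ∈ Finset.range s, ENNReal.ofReal (3 / 16 * b ^ 2) := by
        rw [Finset.sum_const, Finset.card_range, nsmul_eq_mul,
          ENNReal.ofReal_mul (Nat.cast_nonneg s), ENNReal.ofReal_natCast]
    _ ≤ _ := Finset.sum_le_sum hstep
    _ ≤ _ := Finset.sum_le_sum_of_subset (Finset.range_mono hsT)

theorem cumMSE_mono (m : Model n K) (init : ProbabilityMeasure (Fin K)) (μ : Policy n K)
    (r : Rules n K) {s T : ℕ} (h : s ≤ T) : cumMSE m init μ r s ≤ cumMSE m init μ r T :=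
  Finset.sum_le_sum_of_subset (Finset.range_mono h)

/-- The trade-off between estimation and input errors. -/
theorem exists_mul_le_worstMSE_mul (hn : 1 ≤ n) (hK : 1 ≤ K) {Θ : Set (Param n K)}
    {Pi : Set (Vec n)} {σ : ℝ} (hσ : 0 < σ) (hneg : ∀ θ ∈ Θ, ∀ k, NegDef (θ k).1)
    (hint : (interior {θ : Param n K | θ ∈ Θ ∧
      ∀ i, optInput θ (uniformTransition K) i ∈ Pi}).Nonempty) :
    ∃ D : ℝ, 0 < D ∧ ∀ (init : ProbabilityMeasure (Fin K)) (μ : Policy n K) (T : ℕ)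
      (e : Estimator n K), ENNReal.ofReal (D * T) ≤
        worstEstimationMSE Θ Pi σ init μ e T * worstInputMSE Θ Pi σ init μ T := by
  obtain ⟨θ, k, z, δ₀, c, hδ₀, hc, hz, hfam⟩ := exists_tilt_family hn hK isOpen_interior hint
    fun θ hθ => hneg θ (interior_subset hθ).1
  set v : ℝ≥0 := ⟨σ ^ 2, sq_nonneg σ⟩ with hv
  have hvσ : (v : ℝ) = σ ^ 2 := rfl
  have hv0 : v ≠ 0 := fun h => by
    have : (v : ℝ) = 0 := by simp [h]
    rw [hvσ] at this
    exact (pow_pos hσ 2).ne' this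
  have hadm : ∀ δ, 0 ≤ δ → δ ≤ δ₀ → (gaussianModel hK (tilt θ k z δ) k v).Admissible Θ Pi σ :=
    fun δ h0 h1 => gaussianModel_admissible hK k hvσ (interior_subset (hfam δ h0 h1).1).1
      (interior_subset (hfam δ h0 h1).1).2
  have hadm0 : (gaussianModel hK θ k v).Admissible Θ Pi σ := by
    simpa using hadm 0 le_rfl hδ₀.le
  -- The worst case is at least the average over the two models, whence `3/32`. It is used with `s =
  -- 1`, where no information exists yet, and with `s = T`.
  have hbound : ∀ (init : ProbabilityMeasure (Fin K)) (μ : Policy n K) (e : Estimator n K)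
      (s T : ℕ) (δ : ℝ), 0 ≤ δ → δ ≤ δ₀ → s ≤ T →
      (∀ t < s, ∫⁻ h, ENNReal.ofReal (quadVar k v z δ t h)
        ∂law (gaussianModel hK θ k v) init μ t ≤ ENNReal.ofReal (1 / 4)) →
      ENNReal.ofReal (s * (3 / 32 * (c * δ) ^ 2)) ≤ worstEstimationMSE Θ Pi σ init μ e T := by
    intro init μ e s T δ h0 h1 hsT hV
    have h2 := two_point_cumMSE hK θ k hv0 z hz (by positivity) (hfam δ h0 h1).2 init μ e hsT hV
    have h3 : cumMSE (gaussianModel hK θ k v) init μ e T ≤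
        worstEstimationMSE Θ Pi σ init μ e T :=
      le_iSup₂ (f := fun (m : Model n K) (_ : m.Admissible Θ Pi σ) => cumMSE m init μ e T) _ hadm0
    have h4 : cumMSE (gaussianModel hK (tilt θ k z δ) k v) init μ e T ≤
        worstEstimationMSE Θ Pi σ init μ e T :=
      le_iSup₂ (f := fun (m : Model n K) (_ : m.Admissible Θ Pi σ) => cumMSE m init μ e T) _
        (hadm δ h0 h1)
    have h5 := h2.trans (add_le_add h3 h4)
    have h6 : (s : ℝ) * (3 / 16 * (c * δ) ^ 2) = 2 * (s * (3 / 32 * (c * δ) ^ 2)) := by ring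
    rw [h6, ENNReal.ofReal_mul (by norm_num), ENNReal.ofReal_ofNat, ← two_mul] at h5
    exact (ENNReal.mul_le_mul_iff_right (by norm_num) (by norm_num)).1 h5
  set a : ℝ := 3 / 32 * (c * δ₀) ^ 2 with ha
  have ha0 : 0 < a := by positivity
  -- For `δ² = κ / W`, the first entry keeps the information below `1/4`; the second, with `W ≥ a`,
  -- keeps `δ ≤ δ₀`.
  set κ : ℝ := min (σ ^ 2 / 4) (δ₀ ^ 2 * a) with hκ
  have hκ0 : 0 < κ := by positivity
  refine ⟨3 / 32 * c ^ 2 * κ, by positivity, fun init μ T e => ?_⟩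
  rcases Nat.eq_zero_or_pos T with rfl | hT
  · simp
  -- At the first step the history is only `s_0`, so even the largest tilt `δ₀` is undetectable.
  have hpos : ∀ r : Rules n K, ENNReal.ofReal a ≤ worstEstimationMSE Θ Pi σ init μ r T := by
    intro r
    have h := hbound init μ r 1 T δ₀ hδ₀.le le_rfl hT fun t ht => by
      obtain rfl : t = 0 := by omega
      simp [quadVar]
    simpa [ha] using h
  have hin : ENNReal.ofReal a ≤ worstInputMSE Θ Pi σ init μ T := hpos μ
  -- Since `0 * ∞ = 0`, the infinite case needs the other factor to be positive.
  rcases eq_or_ne (worstInputMSE Θ Pi σ init μ T) ∞ with htop | htop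
  · rw [htop, ENNReal.mul_top]
    · exact le_top
    · exact (lt_of_lt_of_le (ENNReal.ofReal_pos.2 ha0) (hpos e)).ne'
  set W := (worstInputMSE Θ Pi σ init μ T).toReal with hW
  have hWeq : worstInputMSE Θ Pi σ init μ T = ENNReal.ofReal W := (ENNReal.ofReal_toReal htop).symm
  have haW : a ≤ W := (ENNReal.ofReal_le_iff_le_toReal htop).1 hin
  have hW0 : 0 < W := ha0.trans_le haW
  have hδsq : Real.sqrt (κ / W) ^ 2 = κ / W := Real.sq_sqrt (by positivity)
  have hδle : Real.sqrt (κ / W) ≤ δ₀ := by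
    refine Real.sqrt_le_iff.2 ⟨hδ₀.le, ?_⟩
    rw [div_le_iff₀ hW0]
    exact (min_le_right _ _).trans (mul_le_mul_of_nonneg_left haW (by positivity))
  have h := hbound init μ e T T (Real.sqrt (κ / W)) (Real.sqrt_nonneg _) hδle le_rfl fun t ht => by
    refine (lintegral_quadVar_le (gaussianModel hK θ k v) k v z _ init μ hz t).trans ?_
    have h1 : cumMSE (gaussianModel hK θ k v) init μ μ t ≤ ENNReal.ofReal W := by
      rw [← hWeq]
      exact (cumMSE_mono _ init μ μ ht.le).trans (le_iSup₂
        (f := fun (m : Model n K) (_ : m.Admissible Θ Pi σ) => cumMSE m init μ μ T) _ hadm0)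
    refine (mul_le_mul_right h1 _).trans ?_
    rw [← ENNReal.ofReal_mul (by positivity), hδsq, hvσ]
    refine ENNReal.ofReal_le_ofReal ?_
    have h2 : κ / W / σ ^ 2 * W = κ / σ ^ 2 := by field_simp
    rw [h2, div_le_iff₀ (by positivity)]
    have := min_le_left (σ ^ 2 / 4) (δ₀ ^ 2 * a)
    linarith
  rw [hWeq]
  refine le_trans (le_of_eq ?_) (mul_le_mul_left h _)
  rw [← ENNReal.ofReal_mul (by positivity), mul_pow, hδsq]
  congr 1
  field_simp

/-- The excess stage cost is exactly a quadratic form in the input error, and coercivity survives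
averaging over the next state. The comparison is pointwise in history and input. -/
theorem mul_cumMSE_le_regret {m : Model n K} {Θ : Set (Param n K)} {Pi : Set (Vec n)} {σ c : ℝ}
    (hc : 0 ≤ c) (hneg : ∀ θ ∈ Θ, ∀ k, NegDef (θ k).1)
    (hcoer : ∀ θ ∈ Θ, ∀ k, ∀ x : Vec n, inner ℝ x ((θ k).1.toEuclideanLin x) ≤ -c * ‖x‖ ^ 2)
    (hm : m.Admissible Θ Pi σ) (init : ProbabilityMeasure (Fin K)) (μ : Policy n K) (T : ℕ) :
    ENNReal.ofReal c * cumMSE m init μ μ T ≤ regret m init μ T := by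
  rw [cumMSE, regret, Finset.mul_sum]
  refine Finset.sum_le_sum fun t _ => ?_
  rw [← lintegral_const_mul' _ _ ENNReal.ofReal_ne_top]
  refine lintegral_mono fun h => ?_
  dsimp only
  rw [← lintegral_const_mul' _ _ ENNReal.ofReal_ne_top]
  refine lintegral_mono fun x => ?_
  dsimp only
  rw [← ENNReal.ofReal_mul hc, stageCost_sub_stageCost_optInput m
    (fun k => (hm.memLp k).integrable one_le_two) hm.mean_zero (hneg _ hm.mem)]
  refine ENNReal.ofReal_le_ofReal ?_
  set i := History.last t h
  set u := x - optInput m.θ m.P i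
  calc c * ‖u‖ ^ 2 = -∑ j, m.P i j * (-c * ‖u‖ ^ 2) := by
        rw [← Finset.sum_mul, m.P_sum]
        ring
    _ ≤ _ := neg_le_neg (Finset.sum_le_sum fun j _ =>
        mul_le_mul_of_nonneg_left (hcoer _ hm.mem j u) (m.P_nonneg i j))

end MarkovJump

theorem mainTheorem8 (n K : ℕ) (hn : 1 ≤ n) (hK : 1 ≤ K)
    (Θ : Set (MarkovJump.Param n K)) (Pi : Set (MarkovJump.Vec n)) (σ : ℝ) (hσ : 0 < σ)
    (hΘ : IsCompact Θ) (hneg : ∀ θ ∈ Θ, ∀ k, MarkovJump.NegDef (θ k).1)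
    (hPi : IsCompact Pi) (hPi' : Convex ℝ Pi)
    (hint : (interior {θ : MarkovJump.Param n K | θ ∈ Θ ∧
      ∀ i, MarkovJump.optInput θ (MarkovJump.uniformTransition K) i ∈ Pi}).Nonempty) :
    ∃ C C' : ℝ, 0 < C ∧ 0 < C' ∧
      ∀ (init : ProbabilityMeasure (Fin K)) (μ : MarkovJump.Policy n K) (T : ℕ),
        (∀ e : MarkovJump.Estimator n K,
          ENNReal.ofReal (C ^ 2 * T) ≤
            MarkovJump.worstEstimationMSE Θ Pi σ init μ e T *
              MarkovJump.worstInputMSE Θ Pi σ init μ T) ∧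
        ENNReal.ofReal (C * Real.sqrt T) ≤ MarkovJump.worstInputMSE Θ Pi σ init μ T ∧
        ENNReal.ofReal (C' * Real.sqrt T) ≤ MarkovJump.worstRegret Θ Pi σ init μ T := by
  obtain ⟨D, hD, hmul⟩ := MarkovJump.exists_mul_le_worstMSE_mul hn hK hσ hneg hint
  obtain ⟨c, hc, hcoer⟩ := MarkovJump.exists_uniform_negDef hΘ hneg
  have hinput : ∀ (init : ProbabilityMeasure (Fin K)) (μ : MarkovJump.Policy n K) (T : ℕ),
      ENNReal.ofReal (Real.sqrt D * Real.sqrt T) ≤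
        MarkovJump.worstInputMSE Θ Pi σ init μ T := fun init μ T => by
    -- The policy serves as its own estimator, so both factors are the input-MSE.
    have h : ENNReal.ofReal (D * T) ≤ MarkovJump.worstInputMSE Θ Pi σ init μ T *
        MarkovJump.worstInputMSE Θ Pi σ init μ T := hmul init μ T μ
    rw [← Real.sqrt_mul hD.le]
    refine le_of_not_gt fun hlt => absurd h (not_le.2 ?_)
    calc _ < _ := ENNReal.mul_lt_mul hlt hlt
      _ = ENNReal.ofReal (D * T) := by
        rw [← ENNReal.ofReal_mul (Real.sqrt_nonneg _), Real.mul_self_sqrt (by positivity)]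
  refine ⟨Real.sqrt D, c * Real.sqrt D, Real.sqrt_pos.2 hD, mul_pos hc (Real.sqrt_pos.2 hD),
    fun init μ T => ⟨fun e => ?_, hinput init μ T, ?_⟩⟩
  · rw [Real.sq_sqrt hD.le]
    exact hmul init μ T e
  · rw [mul_assoc, ENNReal.ofReal_mul hc.le]
    refine (mul_le_mul_right (hinput init μ T) _).trans ?_
    simp only [MarkovJump.worstInputMSE, ENNReal.mul_iSup]
    exact iSup₂_mono fun m hm => MarkovJump.mul_cumMSE_le_regret hc.le hneg hcoer hm init μ T
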